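/- For a Boolean function $f:\{0,1\}^n\to\{0,1\}$ let $\hat f(a)=2^{-n}\sum_{x}(-1)^{f(x)\oplus a\cdot x}$ for $a\in\{0,1\}^n$, and let $\hat f_{\max}=\max_a|\hat f(a)|$. A quantum algorithm with $T$ queries to $f$ starts in a fixed basis state $|x_0,b_0,w_0\rangle$ of an input register of $n$ qubits, an output qubit and a finite-dimensional workspace, applies $U_0,O_f,U_1,O_f,\dots,O_f,U_T$, where $O_f|x,b,w\rangle=|x,b\oplus f(x),w\rangle$ and the $U_t$ are arbitrary unitaries independent of $f$, and accepts or rejects according to a measurement in the computational basis. **Theorem.** For every error bound $0\le\delta<\tfrac12$ there is a constant $c>0$, depending only on $\delta$, such that the following holds for all $n\ge 0$ and all real $\lambda>0$. 1. Suppose that some $n$-bit Boolean function has $\hat f_{\max}=1-4\lambda$. Then every quantum algorithm that, given oracle access to an $n$-bit Boolean function $f$ with the promise that $\hat f_{\max}=1$ or $\hat f_{\max}=1-4\lambda$, decides with error probability at most $\delta$ which is the case (accepting in the first case and rejecting in the second), makes at least $c/\sqrt{\lambda}$ queries. 2. Suppose that $\lambda\le\tfrac18$ and that $2\lambda\cdot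 2^n$ is an integer. Then the all-zero function has $\hat f_{\max}=1$, every $n$-bit Boolean function of Hamming weight $2\lambda\cdot 2^n$ has $\hat f_{\max}=1-4\lambda$, and already every quantum algorithm that distinguishes with error probability at most $\delta$ the all-zero function (accept) from the functions of Hamming weight $2\lambda\cdot 2^n$ (reject) makes at least $c/\sqrt{\lambda}$ queries. -/

import Mathlib

namespace QuantumQuery

/-- The `n`-bit strings `{0,1}ⁿ`, with bits in `ZMod 2` (so that `+` is XOR). -/
abbrev Bits (n : ℕ) : Type := Fin n → ZMod 2

/-- Boolean functions `{0,1}ⁿ → {0,1}`. Their Hamming weight is `hammingNorm`. -/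
abbrev BoolFun (n : ℕ) : Type := Bits n → ZMod 2

/-- The normalised Walsh coefficient `2⁻ⁿ ∑ₓ (-1)^(f(x) ⊕ a·x)`. -/
noncomputable def walsh {n : ℕ} (f : BoolFun n) (a : Bits n) : ℝ :=
  (1 / 2 ^ n) * ∑ x : Bits n, (-1 : ℝ) ^ (f x + a ⬝ᵥ x).val

/-- The largest absolute value of a Walsh coefficient of `f`. -/
noncomputable def fhatMax {n : ℕ} (f : BoolFun n) : ℝ :=
  Finset.univ.sup' Finset.univ_nonempty fun a : Bits n => |walsh f a|

/-- Labels `(x, b, w)` of the computational basis states: the query input register, the query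
output bit and a workspace of dimension `m`. -/
abbrev Label (n m : ℕ) : Type := Bits n × ZMod 2 × Fin m

/-- The oracle of `f`, i.e. the unitary `|x, b, w⟩ ↦ |x, b ⊕ f(x), w⟩`, acting on vectors of
amplitudes. -/
def oracle {n m : ℕ} (f : BoolFun n) (ψ : Label n m → ℂ) : Label n m → ℂ :=
  fun r => ψ (r.1, r.2.1 - f r.1, r.2.2)

/-- A quantum query algorithm with `queries` queries: it starts in a basis state, applies
`U 0, O_f, U 1, O_f, …, O_f, U queries` for arbitrary unitaries `U t` that do not depend on the
function `f` behind the oracle `O_f`, measures in the computational basis, and accepts iff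
the outcome lies in `accept`. (The values `U t` for `queries < t` are not used.) -/
structure Algorithm (n : ℕ) where
  queries : ℕ
  workDim : ℕ
  init : Label n workDim
  U : ℕ → Matrix.unitaryGroup (Label n workDim) ℂ
  accept : Finset (Label n workDim)

namespace Algorithm

variable {n : ℕ}

/-- The state after `t` queries to `f` and the unitary that follows them. -/
noncomputable def state (A : Algorithm n) (f : BoolFun n) : ℕ → Label n A.workDim → ℂ
  | 0 => (A.U 0 : Matrix (Label n A.workDim) (Label n A.workDim) ℂ).mulVec (Pi.single A.init 1)
  | t + 1 => (A.U (t + 1) : Matrix (Label n A.workDim) (Label n A.workDim) ℂ).mulVec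
      (oracle f (A.state f t))

/-- The probability that `A` accepts when it is run with the oracle of `f`. -/
noncomputable def acceptProb (A : Algorithm n) (f : BoolFun n) : ℝ :=
  ∑ r ∈ A.accept, ‖A.state f A.queries r‖ ^ 2

/-- `A` decides with error at most `δ` whether `f ∈ X` or `f ∈ Y`, under the promise that one of
the two holds: it accepts when `f ∈ X` and rejects when `f ∈ Y`. -/
def Decides (A : Algorithm n) (δ : ℝ) (X Y : Set (BoolFun n)) : Prop :=
  (∀ f ∈ X, 1 - A.acceptProb f ≤ δ) ∧ (∀ f ∈ Y, A.acceptProb f ≤ δ)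

end Algorithm

end QuantumQuery

/-!
The all-zero function has maximal Walsh coefficient `1`. A function with maximal coefficient `1 - 4λ`
becomes, after adding an affine function, a function `g` of Hamming weight `2λ·2ⁿ`, and all `2ⁿ`
translates of `g` have the same maximal coefficient. Every input `x` lies in the support of exactly
`2λ·2ⁿ` of these translates, so on average over the translates a query carries only a fraction `2λ` of
its squared amplitude into the support. By the hybrid argument, after `T` queries the mean square
distance between the final states on a translate of `g` and on the zero function is at most `8λT²`,
whereas telling the two apart requires constant distance.

For the second part, two distinct Walsh coefficients of `f` have absolute values of sum at most `1`,
so a coefficient of absolute value at least `1/2` is maximal.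
-/

namespace QuantumQuery

section Hamming

variable {ι α : Type*} [Fintype ι] [Zero α] [DecidableEq α]

theorem hammingNorm_comp_equiv {κ : Type*} [Fintype κ] (f : ι → α) (e : κ ≃ ι) :
    hammingNorm (f ∘ e) = hammingNorm f :=
  Finset.card_equiv e fun x => by simp only [Finset.mem_filter_univ, Function.comp_apply]

theorem exists_hammingNorm_eq [Nontrivial α] {k : ℕ} (hk : k ≤ Fintype.card ι) :
    ∃ f : ι → α, hammingNorm f = k := by
  classical
  obtain ⟨s, -, hs⟩ := Finset.exists_subset_card_eq (hk.trans_eq Finset.card_univ.symm)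
  obtain ⟨y, hy⟩ := exists_ne (0 : α)
  exact ⟨fun i => if i ∈ s then y else 0, by simp [hammingNorm, hy, hs]⟩

end Hamming

section Walsh

variable {n : ℕ}

/-- The sign `(-1)^z` of a bit `z`, as the nontrivial additive character of `ZMod 2`. -/
noncomputable def bitSign : AddChar (ZMod 2) ℝ :=
  AddChar.zmodChar 2 neg_one_sq

theorem bitSign_of_ne_zero {z : ZMod 2} (hz : z ≠ 0) : bitSign z = -1 := by
  obtain rfl : z = 1 := Fin.eq_one_of_ne_zero z hz
  simp [bitSign, AddChar.zmodChar_apply, ZMod.val_one]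

theorem abs_bitSign (z : ZMod 2) : |bitSign z| = 1 := by
  simp [bitSign, AddChar.zmodChar_apply, abs_pow]

theorem bitSign_mul_self (z : ZMod 2) : bitSign z * bitSign z = 1 := by
  rw [← abs_mul_abs_self, abs_bitSign, one_mul]

theorem exists_bitSign_mul_eq_abs (r : ℝ) : ∃ c, bitSign c * r = |r| := by
  rcases abs_choice r with h | h
  · exact ⟨0, by rw [AddChar.map_zero_eq_one, one_mul, h]⟩
  · exact ⟨1, by rw [bitSign_of_ne_zero one_ne_zero, neg_one_mul, h]⟩

/-- The Walsh character `x ↦ (-1)^(a·x)` of the group `{0,1}ⁿ`. -/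
noncomputable def walshChar (a : Bits n) : AddChar (Bits n) ℝ :=
  bitSign.compAddMonoidHom (dotProductBilin (ZMod 2) (ZMod 2) a).toAddMonoidHom

theorem walshChar_apply (a x : Bits n) : walshChar a x = bitSign (a ⬝ᵥ x) := rfl

theorem abs_walshChar (a x : Bits n) : |walshChar a x| = 1 := abs_bitSign _

theorem walshChar_add (a b x : Bits n) : walshChar (a + b) x = walshChar a x * walshChar b x := by
  simp only [walshChar_apply, add_dotProduct, AddChar.map_add_eq_mul]

theorem walshChar_zero (x : Bits n) : walshChar 0 x = 1 := by
  rw [walshChar_apply, zero_dotProduct, AddChar.map_zero_eq_one]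

theorem walshChar_ne_zero {a : Bits n} (ha : a ≠ 0) : walshChar a ≠ 0 := by
  obtain ⟨i, hi⟩ := Function.ne_iff.mp ha
  refine AddChar.ne_zero_iff.mpr ⟨Pi.single i 1, ?_⟩
  rw [walshChar_apply, dotProduct_single_one, bitSign_of_ne_zero hi]
  norm_num

theorem walsh_eq_sum_walshChar (f : BoolFun n) (a : Bits n) :
    walsh f a = (1 / 2 ^ n) * ∑ x, bitSign (f x) * walshChar a x := by
  simp only [walshChar_apply, ← AddChar.map_add_eq_mul]
  rfl

theorem card_bits : Fintype.card (Bits n) = 2 ^ n := by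
  simp [ZMod.card]

theorem walsh_apply_zero (f : BoolFun n) : walsh f 0 = 1 - 2 * hammingNorm f / 2 ^ n := by
  have bitSign_eq (z : ZMod 2) : bitSign z = 1 - 2 * if z ≠ 0 then 1 else 0 := by
    split_ifs with hz
    · rw [bitSign_of_ne_zero hz]; norm_num
    · rw [not_ne_iff.mp hz, AddChar.map_zero_eq_one]; norm_num
  have sum_bitSign : ∑ x, bitSign (f x) = 2 ^ n - 2 * hammingNorm f := by
    simp only [bitSign_eq, Finset.sum_sub_distrib, ← Finset.mul_sum, Finset.sum_boole,
      Finset.sum_const, Finset.card_univ, card_bits, hammingNorm, nsmul_one, Nat.cast_pow,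
      Nat.cast_ofNat]
  simp only [walsh_eq_sum_walshChar, walshChar_zero, mul_one, sum_bitSign]
  field_simp

theorem walsh_zero_eq_iff {f : BoolFun n} {lam : ℝ} :
    walsh f 0 = 1 - 4 * lam ↔ (hammingNorm f : ℝ) = 2 * lam * 2 ^ n := by
  rw [walsh_apply_zero, sub_right_inj, div_eq_iff (by positivity)]
  constructor <;> intro h <;> linarith

theorem sum_abs_bitSign_add_bitSign_mul_walshChar {d : Bits n} (hd : d ≠ 0) (c c' : ZMod 2) :
    ∑ x, |bitSign c + bitSign c' * walshChar d x| = 2 ^ n := by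
  have abs_eq (x : Bits n) : |bitSign c + bitSign c' * walshChar d x| =
      1 + bitSign (c + c') * walshChar d x := by
    have nonneg : 0 ≤ 1 + bitSign (c + c') * walshChar d x := by
      have h : |bitSign (c + c') * walshChar d x| = 1 := by
        rw [abs_mul, abs_bitSign, abs_walshChar, one_mul]
      linarith [neg_le_of_abs_le h.le]
    have factor : bitSign c + bitSign c' * walshChar d x =
        bitSign c * (1 + bitSign (c + c') * walshChar d x) := by
      rw [AddChar.map_add_eq_mul]
      linear_combination -(bitSign c' * walshChar d x) * bitSign_mul_self c
    rw [factor, abs_mul, abs_bitSign, one_mul, abs_of_nonneg nonneg]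
  simp only [abs_eq, Finset.sum_add_distrib, ← Finset.mul_sum,
    AddChar.sum_eq_zero_iff_ne_zero.mpr (walshChar_ne_zero hd), mul_zero, add_zero,
    Finset.sum_const, Finset.card_univ, card_bits, nsmul_one, Nat.cast_pow, Nat.cast_ofNat]

theorem abs_walsh_add_abs_walsh_le_one (f : BoolFun n) {a b : Bits n} (hab : a ≠ b) :
    |walsh f a| + |walsh f b| ≤ 1 := by
  obtain ⟨d, rfl⟩ : ∃ d, b = a + d := ⟨b - a, (add_sub_cancel a b).symm⟩
  have hd : d ≠ 0 := by rintro rfl; exact hab (add_zero a).symm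
  obtain ⟨c, hc⟩ := exists_bitSign_mul_eq_abs (walsh f a)
  obtain ⟨c', hc'⟩ := exists_bitSign_mul_eq_abs (walsh f (a + d))
  calc |walsh f a| + |walsh f (a + d)|
      = 1 / 2 ^ n * ∑ x, bitSign (f x) * walshChar a x *
          (bitSign c + bitSign c' * walshChar d x) := by
        rw [← hc, ← hc']
        simp only [walsh_eq_sum_walshChar, walshChar_add, Finset.mul_sum,
          ← Finset.sum_add_distrib]
        exact Finset.sum_congr rfl fun x _ => by ring
    _ ≤ 1 / 2 ^ n * ∑ x, |bitSign c + bitSign c' * walshChar d x| := by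
        gcongr with x
        refine (le_abs_self _).trans_eq ?_
        rw [abs_mul, abs_mul, abs_bitSign, abs_walshChar, one_mul, one_mul]
    _ = 1 := by rw [sum_abs_bitSign_add_bitSign_mul_walshChar hd]; field_simp

theorem le_fhatMax (f : BoolFun n) (a : Bits n) : |walsh f a| ≤ fhatMax f :=
  Finset.le_sup' (fun a => |walsh f a|) (Finset.mem_univ a)

theorem fhatMax_le_iff {f : BoolFun n} {r : ℝ} : fhatMax f ≤ r ↔ ∀ a, |walsh f a| ≤ r := by
  simp only [fhatMax, Finset.sup'_le_iff, Finset.mem_univ, forall_const]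

theorem exists_abs_walsh_eq_fhatMax (f : BoolFun n) : ∃ a, |walsh f a| = fhatMax f := by
  obtain ⟨a, -, ha⟩ := Finset.exists_mem_eq_sup' Finset.univ_nonempty fun a => |walsh f a|
  exact ⟨a, ha.symm⟩

theorem fhatMax_eq_abs_walsh {f : BoolFun n} {a : Bits n} (ha : 1 / 2 ≤ |walsh f a|) :
    fhatMax f = |walsh f a| := by
  refine le_antisymm (fhatMax_le_iff.mpr fun b => ?_) (le_fhatMax f a)
  obtain rfl | hab := eq_or_ne a b
  · exact le_rfl
  · linarith [abs_walsh_add_abs_walsh_le_one f hab]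

theorem fhatMax_of_hammingNorm_eq {f : BoolFun n} {lam : ℝ} (hlam : lam ≤ 1 / 8)
    (hf : (hammingNorm f : ℝ) = 2 * lam * 2 ^ n) : fhatMax f = 1 - 4 * lam := by
  have hwalsh : |walsh f 0| = 1 - 4 * lam := by
    rw [walsh_zero_eq_iff.mpr hf, abs_of_nonneg (by linarith)]
  rw [fhatMax_eq_abs_walsh (a := 0) (by linarith), hwalsh]

theorem fhatMax_zero : fhatMax (0 : BoolFun n) = 1 := by
  rw [fhatMax_of_hammingNorm_eq (lam := 0)] <;> simp

theorem fhatMax_congr {f g : BoolFun n} (e : Bits n ≃ Bits n)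
    (h : ∀ a, |walsh f a| = |walsh g (e a)|) : fhatMax f = fhatMax g :=
  eq_of_forall_ge_iff fun r => by
    simp only [fhatMax_le_iff, h, e.forall_congr_right (q := fun a => |walsh g a| ≤ r)]

theorem walsh_comp_add_right (f : BoolFun n) (s a : Bits n) :
    walsh (fun x => f (x + s)) a = walshChar a s * walsh f a := by
  rw [walsh_eq_sum_walshChar, walsh_eq_sum_walshChar,
    ← Equiv.sum_comp (Equiv.addRight s) fun x => bitSign (f x) * walshChar a x, mul_left_comm,
    Finset.mul_sum _ _ (walshChar a s)]
  refine congrArg _ (Finset.sum_congr rfl fun x _ => ?_)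
  rw [Equiv.coe_addRight, AddChar.map_add_eq_mul, walshChar_apply a s]
  linear_combination (-(bitSign (f (x + s)) * walshChar a x)) * bitSign_mul_self (a ⬝ᵥ s)

theorem fhatMax_comp_add_right (f : BoolFun n) (s : Bits n) :
    fhatMax (fun x => f (x + s)) = fhatMax f :=
  fhatMax_congr (Equiv.refl _) fun a => by
    rw [walsh_comp_add_right, abs_mul, abs_walshChar, one_mul, Equiv.refl_apply]

theorem walsh_add_affine (f : BoolFun n) (a : Bits n) (c : ZMod 2) (b : Bits n) :
    walsh (fun x => f x + (a ⬝ᵥ x + c)) b = bitSign c * walsh f (b + a) := by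
  simp only [walsh_eq_sum_walshChar, walshChar_add, AddChar.map_add_eq_mul, ← walshChar_apply,
    Finset.mul_sum]
  exact Finset.sum_congr rfl fun x _ => by ring

theorem fhatMax_add_affine (f : BoolFun n) (a : Bits n) (c : ZMod 2) :
    fhatMax (fun x => f x + (a ⬝ᵥ x + c)) = fhatMax f :=
  fhatMax_congr (Equiv.addRight a) fun b => by
    rw [walsh_add_affine, abs_mul, abs_bitSign, one_mul, Equiv.coe_addRight]

theorem exists_walsh_zero_eq_fhatMax (f : BoolFun n) :
    ∃ g : BoolFun n, fhatMax g = fhatMax f ∧ walsh g 0 = fhatMax f := by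
  obtain ⟨a, ha⟩ := exists_abs_walsh_eq_fhatMax f
  obtain ⟨c, hc⟩ := exists_bitSign_mul_eq_abs (walsh f a)
  exact ⟨_, fhatMax_add_affine f a c, by rw [walsh_add_affine, zero_add, hc, ha]⟩

end Walsh

section PiLp

variable {ι : Type*} [Fintype ι] {β : ι → Type*} [∀ i, SeminormedAddCommGroup (β i)]

theorem sum_norm_sq_sub_le (s : Finset ι) (v w : PiLp 2 β) :
    ∑ i ∈ s, ‖v i‖ ^ 2 - ∑ i ∈ s, ‖w i‖ ^ 2 ≤ (‖v‖ + ‖w‖) * ‖v - w‖ := by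
  let restrict (u : PiLp 2 β) : PiLp 2 fun i : s => β i := WithLp.toLp 2 fun i => u i
  have norm_restrict_sq (u : PiLp 2 β) : ‖restrict u‖ ^ 2 = ∑ i ∈ s, ‖u i‖ ^ 2 := by
    rw [PiLp.norm_sq_eq_of_L2]
    exact Finset.sum_coe_sort s fun i => ‖u i‖ ^ 2
  have norm_restrict_le (u : PiLp 2 β) : ‖restrict u‖ ≤ ‖u‖ := by
    rw [← sq_le_sq₀ (norm_nonneg _) (norm_nonneg _), norm_restrict_sq, PiLp.norm_sq_eq_of_L2]
    exact Finset.sum_le_univ_sum_of_nonneg fun i => sq_nonneg _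
  have norm_sub_restrict : ‖restrict v‖ - ‖restrict w‖ ≤ ‖v - w‖ :=
    (norm_sub_norm_le _ _).trans (norm_restrict_le (v - w))
  rw [← norm_restrict_sq, ← norm_restrict_sq, sq_sub_sq]
  exact mul_le_mul_of_nonneg (add_le_add (norm_restrict_le v) (norm_restrict_le w))
    norm_sub_restrict (by positivity) (norm_nonneg _)

end PiLp

section Oracle

variable {n m : ℕ}

/-- The permutation `(x, b, w) ↦ (x, b ⊕ f(x), w)` of the basis labels. -/
def xorPerm (f : BoolFun n) : Equiv.Perm (Label n m) :=
  Function.Involutive.toPerm (fun r => (r.1, r.2.1 + f r.1, r.2.2)) fun r => by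
    simp [add_assoc, CharTwo.add_self_eq_zero]

/-- The oracle of `f` as a unitary operator on the Hilbert space of amplitude vectors. -/
noncomputable def oracleIso (f : BoolFun n) :
    EuclideanSpace ℂ (Label n m) ≃ₗᵢ[ℂ] EuclideanSpace ℂ (Label n m) :=
  LinearIsometryEquiv.piLpCongrLeft 2 ℂ ℂ (xorPerm f)

theorem oracleIso_apply (f : BoolFun n) (v : EuclideanSpace ℂ (Label n m)) (r : Label n m) :
    oracleIso f v r = v (r.1, r.2.1 - f r.1, r.2.2) := by
  rw [CharTwo.sub_eq_add]
  rfl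

theorem oracleIso_toLp (f : BoolFun n) (ψ : Label n m → ℂ) :
    oracleIso f (WithLp.toLp 2 ψ) = WithLp.toLp 2 (oracle f ψ) := by
  ext r
  exact oracleIso_apply f _ r

/-- The query mass of `v` at `x`: the probability that a measurement of the input register of `v`
yields `x`. -/
noncomputable def queryMass (v : EuclideanSpace ℂ (Label n m)) (x : Bits n) : ℝ :=
  ∑ p : ZMod 2 × Fin m, ‖v (x, p)‖ ^ 2

theorem sum_queryMass (v : EuclideanSpace ℂ (Label n m)) : ∑ x, queryMass v x = ‖v‖ ^ 2 := by
  simp only [queryMass, EuclideanSpace.norm_sq_eq, Fintype.sum_prod_type]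

theorem queryMass_oracleIso (f : BoolFun n) (v : EuclideanSpace ℂ (Label n m)) (x : Bits n) :
    queryMass (oracleIso f v) x = queryMass v x := by
  simp only [queryMass, oracleIso_apply]
  exact Equiv.sum_comp ((Equiv.subRight (f x)).prodCongr (Equiv.refl (Fin m)))
    fun p => ‖v (x, p)‖ ^ 2

theorem queryMass_sub_le (v w : EuclideanSpace ℂ (Label n m)) (x : Bits n) :
    queryMass (v - w) x ≤ 2 * (queryMass v x + queryMass w x) := by
  simp only [queryMass, ← Finset.sum_add_distrib, Finset.mul_sum]
  refine Finset.sum_le_sum fun p _ => ?_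
  exact (pow_le_pow_left₀ (norm_nonneg _) (norm_sub_le _ _) 2).trans add_sq_le

theorem queryMass_oracleIso_sub_eq_zero {f g : BoolFun n} {x : Bits n} (hx : f x = g x)
    (v : EuclideanSpace ℂ (Label n m)) : queryMass (oracleIso f v - oracleIso g v) x = 0 := by
  simp [queryMass, oracleIso_apply, hx]

theorem norm_oracleIso_sub_sq_le (f g : BoolFun n) (v : EuclideanSpace ℂ (Label n m)) :
    ‖oracleIso f v - oracleIso g v‖ ^ 2 ≤ 4 * ∑ x with f x ≠ g x, queryMass v x := by
  rw [← sum_queryMass, Finset.sum_filter, Finset.mul_sum]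
  refine Finset.sum_le_sum fun x _ => ?_
  split_ifs with hx
  · refine (queryMass_sub_le _ _ x).trans_eq ?_
    rw [queryMass_oracleIso, queryMass_oracleIso]
    ring
  · rw [queryMass_oracleIso_sub_eq_zero (not_ne_iff.mp hx), mul_zero]

theorem sum_norm_oracleIso_sub_sq_le {ι : Type*} [Fintype ι] {F : ι → BoolFun n} {g : BoolFun n}
    {K : ℕ} (hK : ∀ x, Finset.card {i | F i x ≠ g x} ≤ K) (v : EuclideanSpace ℂ (Label n m)) :
    ∑ i, ‖oracleIso (F i) v - oracleIso g v‖ ^ 2 ≤ 4 * K * ‖v‖ ^ 2 := by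
  have queryMass_nonneg (x : Bits n) : 0 ≤ queryMass v x :=
    Finset.sum_nonneg fun p _ => sq_nonneg _
  calc ∑ i, ‖oracleIso (F i) v - oracleIso g v‖ ^ 2
      ≤ ∑ i, 4 * ∑ x with F i x ≠ g x, queryMass v x :=
        Finset.sum_le_sum fun i _ => norm_oracleIso_sub_sq_le (F i) g v
    _ = 4 * ∑ x, Finset.card {i | F i x ≠ g x} * queryMass v x := by
        simp only [← Finset.mul_sum, Finset.sum_filter]
        rw [Finset.sum_comm]
        simp only [← Finset.sum_filter, Finset.sum_const, nsmul_eq_mul]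
    _ ≤ 4 * ∑ x, K * queryMass v x := by
        gcongr with x
        · exact queryMass_nonneg x
        · exact hK x
    _ = 4 * K * ‖v‖ ^ 2 := by rw [← Finset.mul_sum, sum_queryMass, mul_assoc]

end Oracle

theorem norm_toLp_unitary_mulVec {ι : Type*} [Fintype ι] [DecidableEq ι]
    (U : Matrix.unitaryGroup ι ℂ) (ψ : ι → ℂ) :
    ‖WithLp.toLp 2 ((U : Matrix ι ι ℂ).mulVec ψ)‖ = ‖WithLp.toLp 2 ψ‖ := by
  rw [← Matrix.toEuclideanCLM_toLp]
  exact ContinuousLinearMap.norm_map_of_mem_unitary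
    (Unitary.map_mem (Matrix.toEuclideanCLM (n := ι) (𝕜 := ℂ)) U.2) _

namespace Algorithm

variable {n : ℕ} (A : Algorithm n)

/-- `Algorithm.state` as a vector of the Hilbert space, so that norms of states are `ℓ²`-norms. -/
noncomputable def stateVec (f : BoolFun n) (t : ℕ) : EuclideanSpace ℂ (Label n A.workDim) :=
  WithLp.toLp 2 (A.state f t)

theorem norm_stateVec (f : BoolFun n) (t : ℕ) : ‖A.stateVec f t‖ = 1 := by
  induction t with
  | zero =>
    rw [stateVec, state, norm_toLp_unitary_mulVec, PiLp.toLp_single, PiLp.norm_single, norm_one]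
  | succ t ih =>
    rw [stateVec, state, norm_toLp_unitary_mulVec, ← oracleIso_toLp, LinearIsometryEquiv.norm_map]
    exact ih

theorem norm_stateVec_succ_sub (f g : BoolFun n) (t : ℕ) :
    ‖A.stateVec f (t + 1) - A.stateVec g (t + 1)‖ =
      ‖oracleIso f (A.stateVec f t) - oracleIso g (A.stateVec g t)‖ := by
  rw [stateVec, stateVec, state, state, ← WithLp.toLp_sub, ← Matrix.mulVec_sub,
    norm_toLp_unitary_mulVec, WithLp.toLp_sub, ← oracleIso_toLp, ← oracleIso_toLp]
  rfl

theorem norm_stateVec_sub_le (f g : BoolFun n) (t : ℕ) :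
    ‖A.stateVec f t - A.stateVec g t‖ ≤
      ∑ i ∈ Finset.range t, ‖oracleIso f (A.stateVec g i) - oracleIso g (A.stateVec g i)‖ := by
  induction t with
  | zero => simp [stateVec, state]
  | succ t ih =>
    rw [norm_stateVec_succ_sub, Finset.sum_range_succ]
    refine (norm_sub_le_norm_sub_add_norm_sub _ (oracleIso f (A.stateVec g t)) _).trans ?_
    rw [← map_sub, LinearIsometryEquiv.norm_map]
    gcongr

theorem sum_norm_stateVec_sub_sq_le {ι : Type*} [Fintype ι] {F : ι → BoolFun n} {g : BoolFun n}
    {K : ℕ} (hK : ∀ x, Finset.card {i | F i x ≠ g x} ≤ K) (t : ℕ) :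
    ∑ i, ‖A.stateVec (F i) t - A.stateVec g t‖ ^ 2 ≤ 4 * K * t ^ 2 := by
  let jump (i : ι) (j : ℕ) : ℝ :=
    ‖oracleIso (F i) (A.stateVec g j) - oracleIso g (A.stateVec g j)‖
  have sum_jump_sq_le (j : ℕ) : ∑ i, jump i j ^ 2 ≤ 4 * K := by
    simpa only [norm_stateVec, one_pow, mul_one] using
      sum_norm_oracleIso_sub_sq_le hK (A.stateVec g j)
  calc ∑ i, ‖A.stateVec (F i) t - A.stateVec g t‖ ^ 2
      ≤ ∑ i, (∑ j ∈ Finset.range t, jump i j) ^ 2 := by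
        gcongr with i
        exact A.norm_stateVec_sub_le (F i) g t
    _ ≤ ∑ i, t * ∑ j ∈ Finset.range t, jump i j ^ 2 := by
        gcongr with i
        simpa only [Finset.card_range] using
          sq_sum_le_card_mul_sum_sq (s := Finset.range t) (f := jump i)
    _ = t * ∑ j ∈ Finset.range t, ∑ i, jump i j ^ 2 := by
        rw [← Finset.mul_sum, Finset.sum_comm]
    _ ≤ t * ∑ j ∈ Finset.range t, 4 * (K : ℝ) := by
        gcongr with j
        exact sum_jump_sq_le j
    _ = 4 * K * t ^ 2 := by
        rw [Finset.sum_const, Finset.card_range, nsmul_eq_mul]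
        ring

theorem acceptProb_sub_le (f g : BoolFun n) :
    A.acceptProb f - A.acceptProb g ≤
      2 * ‖A.stateVec f A.queries - A.stateVec g A.queries‖ := by
  refine (sum_norm_sq_sub_le A.accept (A.stateVec f A.queries) (A.stateVec g A.queries)).trans_eq ?_
  rw [norm_stateVec, norm_stateVec, one_add_one_eq_two]

variable {A} {δ : ℝ} {X Y : Set (BoolFun n)}

theorem Decides.le_norm_stateVec_sub (hA : A.Decides δ X Y) {f g : BoolFun n} (hf : f ∈ Y)
    (hg : g ∈ X) : (1 - 2 * δ) / 2 ≤ ‖A.stateVec f A.queries - A.stateVec g A.queries‖ := by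
  rw [norm_sub_rev]
  linarith [A.acceptProb_sub_le g f, hA.1 g hg, hA.2 f hf]

theorem Decides.card_mul_le (hA : A.Decides δ X Y) (hδ : δ ≤ 1 / 2) {ι : Type*} [Fintype ι]
    {F : ι → BoolFun n} (hF : ∀ i, F i ∈ Y) {g : BoolFun n} (hg : g ∈ X) {K : ℕ}
    (hK : ∀ x, Finset.card {i | F i x ≠ g x} ≤ K) :
    Fintype.card ι * (1 - 2 * δ) ^ 2 ≤ 16 * K * (A.queries : ℝ) ^ 2 := by
  have hsum : Fintype.card ι * ((1 - 2 * δ) / 2) ^ 2 ≤ 4 * K * (A.queries : ℝ) ^ 2 :=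
    calc Fintype.card ι * ((1 - 2 * δ) / 2) ^ 2
        = ∑ _i : ι, ((1 - 2 * δ) / 2) ^ 2 := by
          rw [Finset.sum_const, Finset.card_univ, nsmul_eq_mul]
      _ ≤ ∑ i, ‖A.stateVec (F i) A.queries - A.stateVec g A.queries‖ ^ 2 :=
          Finset.sum_le_sum fun i _ =>
            pow_le_pow_left₀ (by linarith) (hA.le_norm_stateVec_sub (hF i) hg) 2
      _ ≤ 4 * K * (A.queries : ℝ) ^ 2 := A.sum_norm_stateVec_sub_sq_le hK A.queries
  linarith

theorem Decides.div_sqrt_le_queries (hA : A.Decides δ X Y) (hδ : δ ≤ 1 / 2) (h0 : 0 ∈ X)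
    {f : BoolFun n} (hY : ∀ s, (fun x => f (x + s)) ∈ Y) {lam : ℝ} (hlam : 0 < lam)
    (hf : (hammingNorm f : ℝ) = 2 * lam * 2 ^ n) :
    (1 - 2 * δ) / 6 / Real.sqrt lam ≤ A.queries := by
  have card_support (x : Bits n) : Finset.card {s | f (x + s) ≠ 0} ≤ hammingNorm f :=
    (hammingNorm_comp_equiv f (Equiv.addLeft x)).le
  have hcard : (2 : ℝ) ^ n * (1 - 2 * δ) ^ 2 ≤ 2 ^ n * (32 * lam * (A.queries : ℝ) ^ 2) := by
    have h := hA.card_mul_le hδ hY h0 card_support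
    rw [card_bits, hf] at h
    push_cast at h
    linarith
  have hsq : (1 - 2 * δ) ^ 2 ≤ 32 * lam * (A.queries : ℝ) ^ 2 :=
    le_of_mul_le_mul_left hcard (by positivity)
  rw [div_le_iff₀ (Real.sqrt_pos.mpr hlam)]
  refine (abs_le_of_sq_le_sq' ?_ (by positivity)).2
  rw [mul_pow, Real.sq_sqrt hlam.le]
  nlinarith [mul_nonneg hlam.le (sq_nonneg (A.queries : ℝ))]

end Algorithm

end QuantumQuery

theorem theorem6p3 (δ : ℝ) (hδ0 : 0 ≤ δ) (hδ : δ < 1 / 2) :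
    ∃ c : ℝ, 0 < c ∧ ∀ (n : ℕ) (lam : ℝ), 0 < lam →
      ((∃ f : QuantumQuery.BoolFun n, QuantumQuery.fhatMax f = 1 - 4 * lam) →
        ∀ A : QuantumQuery.Algorithm n,
          A.Decides δ {f | QuantumQuery.fhatMax f = 1}
            {f | QuantumQuery.fhatMax f = 1 - 4 * lam} →
          c / Real.sqrt lam ≤ (A.queries : ℝ)) ∧
      (lam ≤ 1 / 8 → (∃ k : ℕ, (k : ℝ) = 2 * lam * 2 ^ n) →
        QuantumQuery.fhatMax (0 : QuantumQuery.BoolFun n) = 1 ∧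
        (∀ f : QuantumQuery.BoolFun n, (hammingNorm f : ℝ) = 2 * lam * 2 ^ n →
          QuantumQuery.fhatMax f = 1 - 4 * lam) ∧
        ∀ A : QuantumQuery.Algorithm n,
          A.Decides δ {0} {f | (hammingNorm f : ℝ) = 2 * lam * 2 ^ n} →
          c / Real.sqrt lam ≤ (A.queries : ℝ)) := by
  refine ⟨(1 - 2 * δ) / 6, by linarith, fun n lam hlam => ⟨?_, fun hlam8 ⟨k, hk⟩ =>
    ⟨QuantumQuery.fhatMax_zero, fun f => QuantumQuery.fhatMax_of_hammingNorm_eq hlam8, ?_⟩⟩⟩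
  · rintro ⟨f, hf⟩ A hA
    obtain ⟨g, hgf, hg0⟩ := QuantumQuery.exists_walsh_zero_eq_fhatMax f
    have hweight : (hammingNorm g : ℝ) = 2 * lam * 2 ^ n :=
      QuantumQuery.walsh_zero_eq_iff.mp (hg0.trans hf)
    exact hA.div_sqrt_le_queries hδ.le QuantumQuery.fhatMax_zero
      (fun s => (QuantumQuery.fhatMax_comp_add_right g s).trans (hgf.trans hf)) hlam hweight
  · intro A hA
    have hcard : k ≤ Fintype.card (QuantumQuery.Bits n) := by
      rw [QuantumQuery.card_bits, ← Nat.cast_le (α := ℝ), hk]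
      push_cast
      nlinarith [pow_pos (two_pos (α := ℝ)) n]
    obtain ⟨f, hfk⟩ : ∃ f : QuantumQuery.BoolFun n, hammingNorm f = k :=
      QuantumQuery.exists_hammingNorm_eq hcard
    have hweight : (hammingNorm f : ℝ) = 2 * lam * 2 ^ n := by rw [hfk, hk]
    refine hA.div_sqrt_le_queries hδ.le rfl (fun s => ?_) hlam hweight
    exact (congrArg _ (QuantumQuery.hammingNorm_comp_equiv f (Equiv.addRight s))).trans hweight
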